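/- Let $\hat f(\xi,\eta)=\int_{\mathbb R^2}e^{-2\pi i(x\xi+y\eta)}f(x,y)\,dx\,dy$, extended to $L^2=L^2(\mathbb R^2)$, and let $\|\cdot\|$ be the $L^2$ norm. On $L^2$ let $D_x^{1/2}$, $D_x^{-1/2}\partial_y$ and $\partial_x^{-1}\partial_y$ be the Fourier multiplier operators with symbols $|2\pi\xi|^{1/2}$, $|2\pi\xi|^{-1/2}\,2\pi i\eta$ and $\eta/\xi$, on their maximal domains. For $\lambda,\mu\ge 0$, not both zero, let $X^{1/2}$ be the space of all $f\in L^2$ such that $D_x^{1/2}f\in L^2$, such that $D_x^{-1/2}\partial_yf\in L^2$ if $\lambda>0$, and such that $\partial_x^{-1}\partial_yf\in L^2$ if $\mu>0$, with the norm $$\|f\|_{X^{1/2}}^2=\|f\|^2+\|D_x^{1/2}f\|^2+\lambda\|D_x^{-1/2}\partial_yf\|^2+\mu\|\partial_x^{-1}\partial_yf\|^2 .$$ (a) If $\lambda>0$, $\mu\ge0$ and $0\le p\le2$, there is $C>0$ such that every $f\in X^{1/2}$ lies in $L^{p+2}(\mathbb R^2)$ and $$\|f\|_{L^{p+2}}^{p+2}\le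 C\,\|f\|^{2-p}\,\|D_x^{-1/2}\partial_yf\|^{p/2}\,\|D_x^{1/2}f\|^{3p/2}.$$ (b) If $\lambda=0$, $\mu>0$ and $0\le p\le\frac43$, there is $C>0$ such that every $f\in X^{1/2}$ lies in $L^{p+2}(\mathbb R^2)$ and $$\|f\|_{L^{p+2}}^{p+2}\le C\,\|f\|^{(4-3p)/2}\,\|D_x^{1/2}f\|^{2p}\,\|\partial_x^{-1}\partial_yf\|^{p/2}.$$ (c) In particular, if $\lambda>0$ and $0\le p\le2$, or if $\lambda=0$, $\mu>0$ and $0\le p\le\frac43$, then $X^{1/2}\hookrightarrow L^{p+2}(\mathbb R^2)$: there is $C>0$ such that $f\in L^{p+2}(\mathbb R^2)$ and $\|f\|_{L^{p+2}}\le C\|f\|_{X^{1/2}}$ for every $f\in X^{1/2}$. (Here $0^0=1$.) -/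

import Mathlib

open MeasureTheory
open scoped ENNReal FourierTransform

/-- The plane `ℝ²`, with coordinates `x = z 0`, `y = z 1` (dual variables `ξ = ζ 0`, `η = ζ 1`). -/
abbrev Plane : Type := EuclideanSpace ℝ (Fin 2)

/-- `L²(ℝ²)`, complex valued. -/
abbrev PlaneL2 : Type := Lp ℂ 2 (volume : Measure Plane)

noncomputable section

/-- `m(D) f ∈ L²`: the function `m · f̂` is square integrable, where `f̂` is the Plancherel
transform `f̂(ζ) = ∫ e^{-2πi z·ζ} f(z) dz` of `f ∈ L²`. -/
def MemMultiplierDomain (m : Plane → ℂ) (f : PlaneL2) : Prop :=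
  MemLp (fun ζ => m ζ * (𝓕 f : PlaneL2) ζ) 2 (volume : Measure Plane)

open Classical in
/-- The Fourier multiplier `m(D) f = (m · f̂)^∨` on its maximal domain in `L²`
(and `0` outside that domain). -/
def multiplierOp (m : Plane → ℂ) (f : PlaneL2) : PlaneL2 :=
  if h : MemMultiplierDomain m f then 𝓕⁻ (MemLp.toLp _ h : PlaneL2) else 0

/-- The symbol `|2πξ|^s` of `D_x^s`. -/
def symDx (s : ℝ) (ζ : Plane) : ℂ := ((|2 * Real.pi * ζ 0| ^ s : ℝ) : ℂ)

/-- The symbol `2πiξ` of `∂_x`. -/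
def symPartialX (ζ : Plane) : ℂ := 2 * Real.pi * Complex.I * ζ 0

/-- The symbol `2πiη` of `∂_y`. -/
def symPartialY (ζ : Plane) : ℂ := 2 * Real.pi * Complex.I * ζ 1

/-- The symbol of `D_x^{1/2}`. -/
def symDxHalf (ζ : Plane) : ℂ := symDx (1 / 2) ζ

/-- The symbol of `D_x^{-1/2} ∂_y` (the value on the null set `ξ = 0` is irrelevant). -/
def symDxNegHalfPartialY (ζ : Plane) : ℂ := symDx (-(1 / 2)) ζ * symPartialY ζ

/-- The symbol of `∂_x^{-1} ∂_y` (the value on the null set `ξ = 0` is irrelevant). -/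
def symInvPartialXPartialY (ζ : Plane) : ℂ := (symPartialX ζ)⁻¹ * symPartialY ζ

/-- The space `X^{1/2}` with parameters `lam, mu`: all `f ∈ L²` with `D_x^{1/2} f ∈ L²`, with
`D_x^{-1/2} ∂_y f ∈ L²` if `lam ≠ 0`, and with `∂_x^{-1} ∂_y f ∈ L²` if `mu ≠ 0`. -/
def XHalf (lam mu : ℝ) : Set PlaneL2 :=
  {f | MemMultiplierDomain symDxHalf f ∧
    (lam ≠ 0 → MemMultiplierDomain symDxNegHalfPartialY f) ∧
    (mu ≠ 0 → MemMultiplierDomain symInvPartialXPartialY f)}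

/-- The norm of `X^{1/2}`:
`‖f‖² + ‖D_x^{1/2} f‖² + lam ‖D_x^{-1/2} ∂_y f‖² + mu ‖∂_x^{-1} ∂_y f‖²`, square-rooted. -/
def XHalfNorm (lam mu : ℝ) (f : PlaneL2) : ℝ :=
  Real.sqrt (‖f‖ ^ 2 + ‖multiplierOp symDxHalf f‖ ^ 2 +
    lam * ‖multiplierOp symDxNegHalfPartialY f‖ ^ 2 +
    mu * ‖multiplierOp symInvPartialXPartialY f‖ ^ 2)

/-- The `L^q(ℝ²)` norm of `f`, for real `q > 0`; used together with `f ∈ L^q`. -/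
def lqNorm (q : ℝ) (f : PlaneL2) : ℝ :=
  (eLpNorm f (ENNReal.ofReal q) (volume : Measure Plane)).toReal

/-- `f ∈ L^q(ℝ²)`. -/
def MemLq (q : ℝ) (f : PlaneL2) : Prop :=
  MemLp f (ENNReal.ofReal q) (volume : Measure Plane)

end

/-! Both inequalities come from one level set argument. Put r = 1/2 in (a), r = 1 in (b), a = r +
1/2, and weigh frequencies by w = |ξ| + tη²|ξ|^{-2r} with a free t > 0, so that N = ∫ w|f̂|² is
controlled by the two multiplier norms. The integral of 1/w over {w ≤ M} is at most K M^a with K =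
(4/r)t^{-1/2} (`setLIntegral_inv_anisoWeight_le`). For each height s, cut the frequencies at w =
M(s), where K M(s)^a N = s²/4. By Cauchy–Schwarz the low part is at most s/2 in sup norm, so
Chebyshev and Plancherel bound s²·|{|f| > s}| by 4∫_{w > M(s)} |f̂|². Integrating against s^{2/a-1}
ds yields ∫|f|^{2+2/a} ≲ (KN)^{1/a} N (`lintegral_enorm_rpow_le_of_weight`). Choosing t to balance
the two terms of N makes this multiplicative. Hölder interpolation with L² then gives every p with
pa ≤ 2, that is p ≤ 2 or p ≤ 4/3, and (c) follows by homogeneity. -/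

/-! ### Fourier inversion in L² and the low/high frequency splitting. -/

section
variable {E : Type*} [NormedAddCommGroup E] [InnerProductSpace ℝ E] [FiniteDimensional ℝ E]
  [MeasurableSpace E] [BorelSpace E]

open SchwartzMap in
/-- The `L²` inverse Fourier transform of an integrable function is given by the integral. -/
theorem fourierInv_coeFn_ae_eq (g : Lp ℂ 2 (volume : Measure E)) (hg : Integrable g) :
    ((𝓕⁻ g : Lp ℂ 2 (volume : Measure E)) : E → ℂ) =ᵐ[volume] 𝓕⁻ (g : E → ℂ) := by
  have hL : Continuous fun p : E × E => (-innerₗ E) p.1 p.2 := continuous_inner.neg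
  have hcont : Continuous (𝓕⁻ (g : E → ℂ)) :=
    VectorFourier.fourierIntegral_continuous Real.continuous_fourierChar hL hg
  refine ae_eq_of_integral_contDiff_smul_eq
    ((Lp.memLp (𝓕⁻ g)).locallyIntegrable one_le_two) hcont.locallyIntegrable ?_
  intro φ hφ hφc
  have hφ' : ContDiff ℝ ((⊤ : ℕ∞) : WithTop ℕ∞) (fun x => (φ x : ℂ)) := Complex.ofRealCLM.contDiff.comp hφ
  have hφc' : HasCompactSupport (fun x => (φ x : ℂ)) := hφc.comp_left Complex.ofReal_zero
  let ψ : 𝓢(E, ℂ) := hφc'.toSchwartzMap hφ'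
  have h1 := congrArg (fun T => T ψ) (Lp.fourierInv_toTemperedDistribution_eq g)
  simp only [TemperedDistribution.fourierInv_apply, Lp.toTemperedDistribution_apply] at h1
  -- Self-adjointness of the inverse transform, legitimate because both `ψ` and `g` are integrable.
  have h2 : ∫ x, (𝓕⁻ ψ) x • g x = ∫ x, ψ x • 𝓕⁻ (g : E → ℂ) x := by
    have := VectorFourier.integral_fourierIntegral_smul_eq_flip (L := -innerₗ E)
      Real.continuous_fourierChar hL (ψ.integrable (μ := volume)) hg
    have hf : (-innerₗ E).flip = -innerₗ E := by
      ext x y; simp [real_inner_comm]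
    rw [hf] at this
    rw [SchwartzMap.fourierInv_coe]
    exact this
  rw [h2] at h1
  simpa [ψ] using h1.symm

theorem enorm_fourierInv_coeFn_le (g : Lp ℂ 2 (volume : Measure E)) :
    ∀ᵐ x, ‖(𝓕⁻ g : Lp ℂ 2 (volume : Measure E)) x‖ₑ ≤ ∫⁻ ζ, ‖g ζ‖ₑ := by
  by_cases hg : Integrable g
  · filter_upwards [fourierInv_coeFn_ae_eq g hg] with x hx
    rw [hx, Real.fourierInv_eq]
    refine (enorm_integral_le_lintegral_enorm _).trans (le_of_eq ?_)
    refine lintegral_congr fun ζ => ?_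
    rw [← ofReal_norm, ← ofReal_norm, Circle.norm_smul]
  · have : ∫⁻ ζ, ‖g ζ‖ₑ = ⊤ := by
      by_contra h
      exact hg ⟨Lp.aestronglyMeasurable g, lt_top_iff_ne_top.2 h⟩
    simp [this]

theorem eLpNorm_two_sq {α F : Type*} [MeasurableSpace α] [NormedAddCommGroup F] (μ : Measure α)
    (f : α → F) : eLpNorm f 2 μ ^ 2 = ∫⁻ x, ‖f x‖ₑ ^ 2 ∂μ := by
  rw [eLpNorm_eq_lintegral_rpow_enorm_toReal two_ne_zero ENNReal.ofNat_ne_top,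
    ← ENNReal.rpow_natCast, ← ENNReal.rpow_mul]
  simp

theorem lintegral_enorm_sq_eq {α F : Type*} [MeasurableSpace α] [NormedAddCommGroup F]
    {μ : Measure α} (f : Lp F 2 μ) : ∫⁻ x, ‖f x‖ₑ ^ 2 ∂μ = ENNReal.ofReal (‖f‖ ^ 2) := by
  rw [← eLpNorm_two_sq, ENNReal.ofReal_pow (norm_nonneg _), Lp.norm_def,
    ENNReal.ofReal_toReal (Lp.eLpNorm_ne_top f)]

/-- If the frequencies of `f` in `S` contribute at most `c` in sup norm, then the level set
`{2c < |f|}` is controlled by the `L²` mass of the remaining frequencies. -/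
theorem sq_mul_measure_lt_enorm_le (f : Lp ℂ 2 (volume : Measure E)) {S : Set E}
    (hS : MeasurableSet S) {c : ℝ≥0∞}
    (hc : ∫⁻ ζ in S, ‖(𝓕 f : Lp ℂ 2 (volume : Measure E)) ζ‖ₑ ≤ c) :
    c ^ 2 * volume {x | 2 * c < ‖f x‖ₑ} ≤
      ∫⁻ ζ in Sᶜ, ‖(𝓕 f : Lp ℂ 2 (volume : Measure E)) ζ‖ₑ ^ 2 := by
  set g : Lp ℂ 2 (volume : Measure E) := 𝓕 f with hg
  let gl : Lp ℂ 2 (volume : Measure E) := ((Lp.memLp g).indicator hS).toLp _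
  let gh : Lp ℂ 2 (volume : Measure E) := ((Lp.memLp g).indicator hS.compl).toLp _
  have hgl : gl =ᵐ[volume] S.indicator g := MemLp.coeFn_toLp _
  have hgh : gh =ᵐ[volume] Sᶜ.indicator g := MemLp.coeFn_toLp _
  have hsum : g = gl + gh := by
    apply Lp.ext
    filter_upwards [hgl, hgh, Lp.coeFn_add gl gh] with x h1 h2 h3
    rw [h3, Pi.add_apply, h1, h2, Set.indicator_self_add_compl_apply]
  have hf : f = 𝓕⁻ gl + 𝓕⁻ gh := by
    rw [← FourierTransform.fourierInv_add, ← hsum, hg, FourierTransform.fourierInv_fourier_eq]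
  have hlow : ∀ᵐ x, ‖(𝓕⁻ gl : Lp ℂ 2 (volume : Measure E)) x‖ₑ ≤ c := by
    filter_upwards [enorm_fourierInv_coeFn_le gl] with x hx
    refine hx.trans (le_trans (le_of_eq ?_) hc)
    rw [← lintegral_indicator hS]
    refine lintegral_congr_ae ?_
    filter_upwards [hgl] with ζ hζ
    rw [hζ, enorm_indicator_eq_indicator_enorm]
  -- Since the low part is at most `c` almost everywhere, `|f| > 2c` forces the high part above `c`.
  have hmeas : volume {x | 2 * c < ‖f x‖ₑ} ≤
      volume {x | c ≤ ‖(𝓕⁻ gh : Lp ℂ 2 (volume : Measure E)) x‖ₑ} := by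
    refine measure_mono_ae ?_
    filter_upwards [hlow, Lp.coeFn_add (𝓕⁻ gl) (𝓕⁻ gh)] with x h1 h2 h3
    change 2 * c < ‖f x‖ₑ at h3
    change c ≤ _
    rw [hf, h2, Pi.add_apply, two_mul] at h3
    by_contra! h4
    exact absurd (h3.trans_le (enorm_add_le _ _)) (not_lt.2 (add_le_add h1 h4.le))
  have hcheb := mul_meas_ge_le_pow_eLpNorm' (volume : Measure E) two_ne_zero ENNReal.ofNat_ne_top
    (Lp.aestronglyMeasurable (𝓕⁻ gh)) c
  simp only [ENNReal.toReal_ofNat, ENNReal.rpow_ofNat] at hcheb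
  have hpl : ‖(𝓕⁻ gh : Lp ℂ 2 (volume : Measure E))‖ = ‖gh‖ := by
    rw [← Lp.norm_fourier_eq (𝓕⁻ gh), FourierTransform.fourier_fourierInv_eq]
  rw [eLpNorm_two_sq, lintegral_enorm_sq_eq, hpl, ← lintegral_enorm_sq_eq] at hcheb
  calc _ ≤ _ := by gcongr
    _ ≤ _ := hcheb
    _ = _ := by
      rw [← lintegral_indicator hS.compl]
      refine lintegral_congr_ae ?_
      filter_upwards [hgh] with ζ hζ
      rw [hζ]
      by_cases h : ζ ∈ Sᶜ <;> simp [h, Set.indicator]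
end

/-! ### Sobolev inequality for a general frequency weight. -/

section
variable {E : Type*} [NormedAddCommGroup E] [InnerProductSpace ℝ E] [FiniteDimensional ℝ E]
  [MeasurableSpace E] [BorelSpace E]

/-- Cauchy–Schwarz applied to |g| = w^{-1/2} · w^{1/2}|g|. -/
theorem lintegral_enorm_le_of_weight {α : Type*} [MeasurableSpace α] {μ : Measure α} {w : α → ℝ}
    (hw : Measurable w) (hw0 : ∀ᵐ x ∂μ, 0 < w x) {g : α → ℂ} (hg : AEStronglyMeasurable g μ)
    {A B : ℝ} (hA : 0 ≤ A) (h1 : ∫⁻ x, ENNReal.ofReal (w x)⁻¹ ∂μ ≤ ENNReal.ofReal A)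
    (h2 : ∫⁻ x, ENNReal.ofReal (w x) * ‖g x‖ₑ ^ 2 ∂μ ≤ ENNReal.ofReal B) :
    ∫⁻ x, ‖g x‖ₑ ∂μ ≤ ENNReal.ofReal (Real.sqrt (A * B)) := by
  have hae : ∫⁻ x, ‖g x‖ₑ ∂μ = ∫⁻ x, (ENNReal.ofReal (w x)⁻¹) ^ (1 / 2 : ℝ) *
      (ENNReal.ofReal (w x) * ‖g x‖ₑ ^ 2) ^ (1 / 2 : ℝ) ∂μ := by
    refine lintegral_congr_ae ?_
    filter_upwards [hw0] with x hx
    rw [← ENNReal.mul_rpow_of_nonneg _ _ (by norm_num), ← mul_assoc,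
      ← ENNReal.ofReal_mul (inv_nonneg.2 hx.le), inv_mul_cancel₀ hx.ne', ENNReal.ofReal_one,
      one_mul, ← ENNReal.rpow_natCast, ← ENNReal.rpow_mul]
    simp
  rw [hae]
  calc _ ≤ _ := ENNReal.lintegral_mul_norm_pow_le hw.inv.ennreal_ofReal.aemeasurable
        (hw.ennreal_ofReal.aemeasurable.mul (hg.enorm.pow_const 2)) (by norm_num) (by norm_num)
        (by norm_num)
    _ ≤ ENNReal.ofReal A ^ (1 / 2 : ℝ) * ENNReal.ofReal B ^ (1 / 2 : ℝ) := by
      gcongr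
      · exact h1
      · exact h2
    _ = _ := by
      rw [← ENNReal.mul_rpow_of_nonneg _ _ (by norm_num), ← ENNReal.ofReal_mul hA,
        Real.sqrt_eq_rpow]
      rcases le_or_gt 0 (A * B) with h | h
      · rw [ENNReal.ofReal_rpow_of_nonneg h (by norm_num)]
      · rw [ENNReal.ofReal_of_nonpos h.le, ← Real.sqrt_eq_rpow, Real.sqrt_eq_zero_of_nonpos h.le]
        simp

/-- A Sobolev inequality for a general frequency weight, by the level set method. -/
theorem lintegral_enorm_rpow_le_of_weight {w : E → ℝ} (hw : Measurable w) (hw0 : ∀ ζ, 0 ≤ w ζ)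
    (hwpos : ∀ᵐ ζ, 0 < w ζ) {K a : ℝ} (hK : 0 < K) (ha : 0 < a)
    (hKM : ∀ M > 0, ∫⁻ ζ in {ζ | w ζ ≤ M}, ENNReal.ofReal (w ζ)⁻¹ ≤ ENNReal.ofReal (K * M ^ a))
    (f : Lp ℂ 2 (volume : Measure E)) {N : ℝ} (hN : 0 < N)
    (hfN : ∫⁻ ζ, ENNReal.ofReal (w ζ) * ‖(𝓕 f : Lp ℂ 2 (volume : Measure E)) ζ‖ₑ ^ 2 ≤
      ENNReal.ofReal N) :
    ∫⁻ x, ‖f x‖ₑ ^ (2 + 2 / a) ≤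
      ENNReal.ofReal ((2 + 2 / a) * 4 / (2 / a) * (4 * K * N) ^ (1 / a) * N) := by
  set g : Lp ℂ 2 (volume : Measure E) := 𝓕 f with hg
  have hgm : AEMeasurable (fun ζ => ‖g ζ‖ₑ ^ 2) volume :=
    (Lp.aestronglyMeasurable g).enorm.pow_const 2
  have hKN : 0 < 4 * K * N := by positivity
  -- `Lam ζ` is the height at which `ζ` passes from the high to the low part: `Lam ζ ≤ s` means K
  -- w^a N ≤ s²/4.
  let Lam : E → ℝ := fun ζ => Real.sqrt (4 * K * N * w ζ ^ a)
  have hLam : Measurable Lam := ((hw.pow_const a).const_mul _).sqrt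
  -- With this measure the high-frequency mass is the distribution function of `Lam`, so the
  -- layer-cake formula applies on the frequency side as well.
  let ν : Measure E := volume.withDensity fun ζ => ‖g ζ‖ₑ ^ 2
  have hlevel : ∀ s : ℝ, 0 < s → volume {x | s < ‖f x‖} * ENNReal.ofReal (s ^ 2) ≤
      4 * ν {ζ | s < Lam ζ} := by
    intro s hs
    have hS : MeasurableSet {ζ | Lam ζ ≤ s} := measurableSet_le hLam measurable_const
    have hc : ∫⁻ ζ in {ζ | Lam ζ ≤ s}, ‖g ζ‖ₑ ≤ ENNReal.ofReal (s / 2) := by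
      have hsub : {ζ | Lam ζ ≤ s} ⊆ {ζ | w ζ ≤ (s ^ 2 / (4 * K * N)) ^ a⁻¹} := by
        intro ζ hζ
        have h1 : 4 * K * N * w ζ ^ a ≤ s ^ 2 := (Real.sqrt_le_left hs.le).1 hζ
        have h2 : w ζ ^ a ≤ s ^ 2 / (4 * K * N) := by
          rw [le_div_iff₀ hKN]; linarith
        exact (Real.le_rpow_inv_iff_of_pos (hw0 ζ) (by positivity) ha).2 h2
      have h1 : ∫⁻ ζ in {ζ | Lam ζ ≤ s}, ENNReal.ofReal (w ζ)⁻¹ ≤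
          ENNReal.ofReal (s ^ 2 / (4 * N)) := by
        refine (lintegral_mono_set hsub).trans ((hKM _ (by positivity)).trans (le_of_eq ?_))
        rw [Real.rpow_inv_rpow (by positivity) ha.ne']
        congr 1
        field_simp
      have h3 := lintegral_enorm_le_of_weight hw (ae_restrict_of_ae hwpos)
        (Lp.aestronglyMeasurable g).restrict (by positivity) h1
        ((setLIntegral_le_lintegral _ _).trans hfN)
      refine h3.trans (le_of_eq ?_)
      congr 1
      rw [show s ^ 2 / (4 * N) * N = (s / 2) ^ 2 by field_simp; ring]
      exact Real.sqrt_sq (by positivity)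
    have h := sq_mul_measure_lt_enorm_le f hS hc
    have hset : {x | 2 * ENNReal.ofReal (s / 2) < ‖f x‖ₑ} = {x | s < ‖f x‖} := by
      ext x
      have : 2 * ENNReal.ofReal (s / 2) = ENNReal.ofReal s := by
        rw [← ENNReal.ofReal_ofNat 2, ← ENNReal.ofReal_mul (by norm_num)]
        congr 1; ring
      simp only [Set.mem_ofPred_eq]
      rw [this, ← ofReal_norm, ENNReal.ofReal_lt_ofReal_iff_of_nonneg hs.le]
    have hcompl : {ζ | Lam ζ ≤ s}ᶜ = {ζ | s < Lam ζ} := by ext; simp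
    rw [hset, hcompl, ← hg] at h
    have hν : ν {ζ | s < Lam ζ} = ∫⁻ ζ in {ζ | s < Lam ζ}, ‖g ζ‖ₑ ^ 2 :=
      withDensity_apply _ (measurableSet_lt measurable_const hLam)
    rw [hν]
    calc _ = 4 * (ENNReal.ofReal (s / 2) ^ 2 * volume {x | s < ‖f x‖}) := by
          rw [← mul_assoc, mul_comm, ← ENNReal.ofReal_pow (by positivity),
            ← ENNReal.ofReal_ofNat 4, ← ENNReal.ofReal_mul (by norm_num)]
          congr 2; ring
      _ ≤ _ := by gcongr
  -- The exponent for which `Lam ^ b` is a constant multiple of `w`, so that its integral against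
  -- `ν` is bounded through `N`.
  set b : ℝ := 2 / a with hb
  have hb0 : 0 < b := by positivity
  have hf1 : ∫⁻ x, ‖f x‖ₑ ^ (2 + b) = ENNReal.ofReal (2 + b) *
      ∫⁻ s in Set.Ioi (0 : ℝ), volume {x | s < ‖f x‖} * ENNReal.ofReal (s ^ (2 + b - 1)) := by
    rw [← lintegral_rpow_eq_lintegral_meas_lt_mul volume
      (Filter.Eventually.of_forall fun x => norm_nonneg _)
      (Lp.aestronglyMeasurable f).norm.aemeasurable (by positivity)]
    refine lintegral_congr fun x => ?_
    rw [← ofReal_norm, ENNReal.ofReal_rpow_of_nonneg (norm_nonneg _) (by positivity)]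
  have hg1 := lintegral_rpow_eq_lintegral_meas_lt_mul ν (f := Lam)
      (Filter.Eventually.of_forall fun x => Real.sqrt_nonneg _) hLam.aemeasurable hb0
  have hg2 : ∫⁻ ζ, ENNReal.ofReal (Lam ζ ^ b) ∂ν ≤
      ENNReal.ofReal ((4 * K * N) ^ (1 / a) * N) := by
    rw [lintegral_withDensity_eq_lintegral_mul₀ hgm
      (hLam.pow_const b).ennreal_ofReal.aemeasurable]
    calc _ = ∫⁻ ζ, ENNReal.ofReal ((4 * K * N) ^ (1 / a)) *
          (ENNReal.ofReal (w ζ) * ‖g ζ‖ₑ ^ 2) := by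
          refine lintegral_congr fun ζ => ?_
          have : Lam ζ ^ b = (4 * K * N) ^ (1 / a) * w ζ := by
            have hwa : 0 ≤ w ζ ^ a := Real.rpow_nonneg (hw0 ζ) _
            simp only [Lam]
            rw [Real.sqrt_eq_rpow, ← Real.rpow_mul (by positivity),
              show 1 / 2 * b = 1 / a by rw [hb]; ring, Real.mul_rpow hKN.le hwa, one_div,
              Real.rpow_rpow_inv (hw0 ζ) ha.ne']
          rw [Pi.mul_apply, this, ENNReal.ofReal_mul (by positivity)]
          ring
      _ = _ := lintegral_const_mul' _ _ ENNReal.ofReal_ne_top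
      _ ≤ ENNReal.ofReal ((4 * K * N) ^ (1 / a)) * ENNReal.ofReal N := by gcongr
      _ = _ := by rw [ENNReal.ofReal_mul (by positivity)]
  rw [hf1]
  calc _ ≤ ENNReal.ofReal (2 + b) * ∫⁻ s in Set.Ioi (0 : ℝ),
        4 * (ν {ζ | s < Lam ζ} * ENNReal.ofReal (s ^ (b - 1))) := by
        gcongr 1
        refine setLIntegral_mono' measurableSet_Ioi fun s hs => ?_
        have hs : 0 < s := hs
        rw [show 2 + b - 1 = 2 + (b - 1) by ring, Real.rpow_add hs, Real.rpow_two,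
          ENNReal.ofReal_mul (by positivity), ← mul_assoc, ← mul_assoc]
        gcongr ?_ * _
        exact hlevel s hs
    _ = ENNReal.ofReal (2 + b) * 4 / ENNReal.ofReal b * ∫⁻ ζ, ENNReal.ofReal (Lam ζ ^ b) ∂ν := by
        rw [hg1, lintegral_const_mul' _ _ (by norm_num), ← mul_assoc, ← mul_assoc,
          ENNReal.div_mul_cancel (by simpa using hb0) ENNReal.ofReal_ne_top]
    _ ≤ ENNReal.ofReal (2 + b) * 4 / ENNReal.ofReal b *
          ENNReal.ofReal ((4 * K * N) ^ (1 / a) * N) := by gcongr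
    _ = _ := by
        rw [show (4 : ℝ≥0∞) = ENNReal.ofReal 4 by simp, ← ENNReal.ofReal_mul (by positivity),
          ← ENNReal.ofReal_div_of_pos hb0, ← ENNReal.ofReal_mul (by positivity), ← mul_assoc]
end

/-! ### The anisotropic weight and its sublevel sets. -/

theorem setLIntegral_Icc_abs_rpow_le {r M : ℝ} (hr : 0 < r) (hM : 0 < M) :
    ∫⁻ x in Set.Icc (-M) M, ENNReal.ofReal (|x| ^ (r - 1)) ≤ ENNReal.ofReal (2 * (M ^ r / r)) := by
  have hpos : ∫⁻ x in Set.Icc 0 M, ENNReal.ofReal (|x| ^ (r - 1)) = ENNReal.ofReal (M ^ r / r) := by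
    rw [setLIntegral_congr Ioc_ae_eq_Icc.symm]
    have hint : IntegrableOn (fun x : ℝ => x ^ (r - 1)) (Set.Ioc 0 M) :=
      (intervalIntegrable_iff_integrableOn_Ioc_of_le hM.le).1
        (intervalIntegral.intervalIntegrable_rpow' (by linarith))
    have h1 : ∫⁻ x in Set.Ioc 0 M, ENNReal.ofReal (|x| ^ (r - 1)) =
        ∫⁻ x in Set.Ioc 0 M, ENNReal.ofReal (x ^ (r - 1)) :=
      setLIntegral_congr_fun measurableSet_Ioc fun x hx => by
        simp only [abs_of_pos hx.1]
    rw [h1, ← ofReal_integral_eq_lintegral_ofReal hint, ← intervalIntegral.integral_of_le hM.le,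
      integral_rpow (Or.inl (by linarith))]
    · simp [Real.zero_rpow hr.ne']
    · filter_upwards [ae_restrict_mem measurableSet_Ioc] with x hx
      exact Real.rpow_nonneg hx.1.le _
  have hneg : ∫⁻ x in Set.Icc (-M) 0, ENNReal.ofReal (|x| ^ (r - 1)) =
      ∫⁻ x in Set.Icc 0 M, ENNReal.ofReal (|x| ^ (r - 1)) := by
    have := (Measure.measurePreserving_neg (volume : Measure ℝ)).setLIntegral_comp_preimage
      (s := Set.Icc 0 M) measurableSet_Icc (f := fun x => ENNReal.ofReal (|x| ^ (r - 1)))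
      (by fun_prop)
    simpa using this
  rw [← Set.Icc_union_Icc_eq_Icc (b := 0) (by linarith) hM.le]
  refine (lintegral_union_le _ _ _).trans (le_of_eq ?_)
  rw [hneg, hpos, ← ENNReal.ofReal_add (by positivity) (by positivity), two_mul]

theorem measurePreserving_plane_prod :
    MeasurePreserving (fun ζ : Plane => (ζ 0, ζ 1)) volume volume :=
  (volume_preserving_finTwoArrow ℝ).comp (PiLp.volume_preserving_ofLp (Fin 2))

/-- The anisotropic frequency weight `|ξ| + t η² |ξ|^{-2r}`. -/
noncomputable def anisoWeight (r t : ℝ) (ζ : Plane) : ℝ :=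
  |ζ 0| + t * (ζ 1 ^ 2 * |ζ 0| ^ (-(2 * r)))

theorem measurable_anisoWeight (r t : ℝ) : Measurable (anisoWeight r t) := by
  unfold anisoWeight
  fun_prop

theorem anisoWeight_nonneg (r : ℝ) {t : ℝ} (ht : 0 ≤ t) (ζ : Plane) : 0 ≤ anisoWeight r t ζ := by
  unfold anisoWeight
  positivity

theorem anisoWeight_pos (r : ℝ) {t : ℝ} (ht : 0 ≤ t) : ∀ᵐ ζ : Plane, 0 < anisoWeight r t ζ := by
  have h0 : ∀ᵐ p : ℝ × ℝ, p.1 ≠ 0 :=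
    Measure.quasiMeasurePreserving_fst.ae (Measure.ae_ne volume 0)
  filter_upwards [measurePreserving_plane_prod.quasiMeasurePreserving.ae h0] with ζ hζ
  have : 0 < |ζ 0| := abs_pos.2 hζ
  unfold anisoWeight
  positivity

/-- On the sublevel set |ξ| ≤ M, |η| ≤ (M/t)^{1/2}|ξ|^r and 1/w ≤ 1/|ξ|. Integrating in η leaves
2(M/t)^{1/2}|ξ|^{r-1}, which is integrable at 0 because r > 0. -/
theorem setLIntegral_inv_anisoWeight_le {r t M : ℝ} (hr : 0 < r) (ht : 0 < t) (hM : 0 < M) :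
    ∫⁻ ζ in {ζ | anisoWeight r t ζ ≤ M}, ENNReal.ofReal (anisoWeight r t ζ)⁻¹ ≤
      ENNReal.ofReal (4 / r * t ^ (-(1 / 2) : ℝ) * M ^ (r + 1 / 2)) := by
  let ρ : ℝ → ℝ := fun x => (M / t) ^ (1 / 2 : ℝ) * |x| ^ r
  have hρ : Measurable ρ := by fun_prop
  let S : Set (ℝ × ℝ) := {p | |p.1| ≤ M ∧ |p.2| ≤ ρ p.1}
  have hS : MeasurableSet S :=
    (measurableSet_le (f := fun p : ℝ × ℝ => |p.1|) (by fun_prop) measurable_const).inter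
      (measurableSet_le (f := fun p : ℝ × ℝ => |p.2|) (by fun_prop) (hρ.comp measurable_fst))
  let G : ℝ × ℝ → ℝ≥0∞ := S.indicator fun p => ENNReal.ofReal |p.1|⁻¹
  have hG : Measurable G := Measurable.indicator (by fun_prop) hS
  have hle : ∀ ζ : Plane, ({ζ | anisoWeight r t ζ ≤ M}).indicator
      (fun ζ => ENNReal.ofReal (anisoWeight r t ζ)⁻¹) ζ ≤ G (ζ 0, ζ 1) := by
    intro ζ
    by_cases hζ : anisoWeight r t ζ ≤ M
    swap
    · simp [hζ]
    rw [Set.indicator_of_mem (by exact hζ)]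
    -- On this line the conventions for powers of 0 and `0⁻¹` make the integrand zero.
    by_cases h0 : ζ 0 = 0
    · have : anisoWeight r t ζ = 0 := by
        simp [anisoWeight, h0, Real.zero_rpow, hr.ne']
      simp [this]
    have hx : 0 < |ζ 0| := abs_pos.2 h0
    have h1 : 0 ≤ t * (ζ 1 ^ 2 * |ζ 0| ^ (-(2 * r))) := by positivity
    have hmem : ((ζ 0, ζ 1) : ℝ × ℝ) ∈ S := by
      unfold anisoWeight at hζ
      refine ⟨by change |ζ 0| ≤ M; linarith, ?_⟩
      change |ζ 1| ≤ (M / t) ^ (1 / 2 : ℝ) * |ζ 0| ^ r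
      refine abs_le_of_sq_le_sq ?_ (by positivity)
      have h2 : t * (ζ 1 ^ 2 * |ζ 0| ^ (-(2 * r))) ≤ M := by linarith
      rw [Real.rpow_neg hx.le, ← div_eq_mul_inv, ← mul_div_assoc,
        div_le_iff₀ (by positivity)] at h2
      have h3 : ((M / t) ^ (1 / 2 : ℝ) * |ζ 0| ^ r) ^ 2 = M / t * |ζ 0| ^ (2 * r) := by
        rw [mul_pow, ← Real.rpow_natCast, ← Real.rpow_natCast, ← Real.rpow_mul (by positivity),
          ← Real.rpow_mul hx.le]
        norm_num [mul_comm]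
      rw [h3, div_mul_eq_mul_div, le_div_iff₀ ht]
      linarith
    rw [show G (ζ 0, ζ 1) = ENNReal.ofReal |ζ 0|⁻¹ from Set.indicator_of_mem hmem _]
    refine ENNReal.ofReal_le_ofReal (inv_anti₀ hx ?_)
    unfold anisoWeight
    linarith
  have hinner : ∀ x : ℝ, ∫⁻ y, G (x, y) ≤ (Set.Icc (-M) M).indicator
      (fun x => ENNReal.ofReal (2 * (M / t) ^ (1 / 2 : ℝ)) * ENNReal.ofReal (|x| ^ (r - 1))) x := by
    intro x
    by_cases hx : |x| ≤ M
    swap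
    · have : ∀ y, G (x, y) = 0 := fun y => Set.indicator_of_notMem (fun h => hx h.1) _
      simp [this]
    rw [Set.indicator_of_mem (Set.mem_Icc.2 (abs_le.1 hx))]
    have : ∀ y, G (x, y) = (Set.Icc (-ρ x) (ρ x)).indicator (fun _ => ENNReal.ofReal |x|⁻¹) y := by
      intro y
      by_cases hy : |y| ≤ ρ x
      · rw [Set.indicator_of_mem (Set.mem_Icc.2 (abs_le.1 hy))]
        exact Set.indicator_of_mem (show (x, y) ∈ S from ⟨hx, hy⟩) _
      · rw [Set.indicator_of_notMem (fun h => hy (abs_le.2 (Set.mem_Icc.1 h)))]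
        exact Set.indicator_of_notMem (fun h : (x, y) ∈ S => hy h.2) _
    simp_rw [this]
    rw [lintegral_indicator_const measurableSet_Icc, Real.volume_Icc,
      ← ENNReal.ofReal_mul (by positivity), ← ENNReal.ofReal_mul (by positivity)]
    refine ENNReal.ofReal_le_ofReal ?_
    by_cases h0 : x = 0
    · simp only [h0, abs_zero, inv_zero, zero_mul]
      positivity
    have hx0 : 0 < |x| := abs_pos.2 h0
    rw [Real.rpow_sub_one hx0.ne']
    apply le_of_eq
    simp only [ρ]
    ring
  rw [← lintegral_indicator (measurableSet_le (measurable_anisoWeight r t) measurable_const)]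
  calc _ ≤ ∫⁻ ζ : Plane, G (ζ 0, ζ 1) := lintegral_mono hle
    _ = ∫⁻ p, G p := measurePreserving_plane_prod.lintegral_comp hG
    _ = ∫⁻ x, ∫⁻ y, G (x, y) := lintegral_prod _ hG.aemeasurable
    _ ≤ _ := lintegral_mono hinner
    _ = ENNReal.ofReal (2 * (M / t) ^ (1 / 2 : ℝ)) *
        ∫⁻ x in Set.Icc (-M) M, ENNReal.ofReal (|x| ^ (r - 1)) := by
      rw [lintegral_indicator measurableSet_Icc, lintegral_const_mul' _ _ ENNReal.ofReal_ne_top]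
    _ ≤ ENNReal.ofReal (2 * (M / t) ^ (1 / 2 : ℝ)) * ENNReal.ofReal (2 * (M ^ r / r)) := by
      gcongr
      exact setLIntegral_Icc_abs_rpow_le hr hM
    _ = _ := by
      rw [← ENNReal.ofReal_mul (by positivity), Real.div_rpow hM.le ht.le, Real.rpow_add hM,
        Real.rpow_neg ht.le]
      congr 1
      field_simp
      ring

/-! ### Multiplier norms and the weighted energy. -/

theorem lintegral_enorm_symbol_eq {m : Plane → ℂ} {f : PlaneL2} (h : MemMultiplierDomain m f) :
    ∫⁻ ζ, ‖m ζ‖ₑ ^ 2 * ‖(𝓕 f : PlaneL2) ζ‖ₑ ^ 2 = ENNReal.ofReal (‖multiplierOp m f‖ ^ 2) := by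
  have hn : ‖multiplierOp m f‖ = ‖(MemLp.toLp _ h : PlaneL2)‖ := by
    rw [multiplierOp, dif_pos h, ← Lp.norm_fourier_eq, FourierTransform.fourier_fourierInv_eq]
  rw [hn, ← lintegral_enorm_sq_eq]
  refine lintegral_congr_ae ?_
  filter_upwards [MemLp.coeFn_toLp h] with ζ hζ
  rw [hζ, enorm_mul, mul_pow]

theorem abs_le_norm_symDxHalf_sq (ζ : Plane) : |ζ 0| ≤ ‖symDxHalf ζ‖ ^ 2 := by
  have h : ‖symDxHalf ζ‖ ^ 2 = |2 * Real.pi * ζ 0| := by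
    rw [symDxHalf, symDx, Complex.norm_real, Real.norm_of_nonneg (by positivity),
      ← Real.rpow_natCast, ← Real.rpow_mul (abs_nonneg _)]
    norm_num
  rw [h, abs_mul, abs_of_pos Real.two_pi_pos]
  nlinarith [Real.pi_gt_three, abs_nonneg (ζ 0)]

theorem norm_symPartialY (ζ : Plane) : ‖symPartialY ζ‖ = 2 * Real.pi * |ζ 1| := by
  simp [symPartialY, abs_of_pos Real.pi_pos]

theorem norm_symPartialX (ζ : Plane) : ‖symPartialX ζ‖ = 2 * Real.pi * |ζ 0| := by
  simp [symPartialX, abs_of_pos Real.pi_pos]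

/-- The case r = 1/2 of the weight; the two sides differ only by a factor 2π ≥ 1. -/
theorem le_norm_symDxNegHalfPartialY_sq (ζ : Plane) :
    ζ 1 ^ 2 * |ζ 0| ^ (-(2 * (1 / 2)) : ℝ) ≤ ‖symDxNegHalfPartialY ζ‖ ^ 2 := by
  have h : ‖symDxNegHalfPartialY ζ‖ ^ 2 = 2 * Real.pi * (ζ 1 ^ 2 * |ζ 0| ^ (-1 : ℝ)) := by
    rw [symDxNegHalfPartialY, symDx, norm_mul, Complex.norm_real,
      Real.norm_of_nonneg (by positivity), norm_symPartialY, mul_pow, ← Real.rpow_natCast,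
      ← Real.rpow_mul (abs_nonneg _), mul_pow, sq_abs]
    norm_num
    rw [Real.rpow_neg_one, Real.rpow_neg_one, abs_of_pos Real.pi_pos]
    have := Real.pi_pos
    field_simp
  rw [h]
  have h0 : 0 ≤ ζ 1 ^ 2 * |ζ 0| ^ (-1 : ℝ) := by positivity
  norm_num at h0 ⊢
  nlinarith [Real.pi_gt_three]

/-- The case r = 1 of the weight; the factors 2π cancel, so equality holds, even at ξ = 0 by
convention. -/
theorem le_norm_symInvPartialXPartialY_sq (ζ : Plane) :
    ζ 1 ^ 2 * |ζ 0| ^ (-(2 * 1) : ℝ) ≤ ‖symInvPartialXPartialY ζ‖ ^ 2 := by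
  apply le_of_eq
  rw [symInvPartialXPartialY, norm_mul, norm_inv, norm_symPartialY, norm_symPartialX,
    Real.rpow_neg (abs_nonneg _), mul_one, Real.rpow_two, sq_abs, ← div_eq_inv_mul,
    mul_div_mul_left _ _ Real.two_pi_pos.ne', div_pow, sq_abs, sq_abs, div_eq_mul_inv]

theorem lintegral_anisoWeight_le {r : ℝ} {m : Plane → ℂ}
    (hm : ∀ ζ : Plane, ζ 1 ^ 2 * |ζ 0| ^ (-(2 * r)) ≤ ‖m ζ‖ ^ 2) {f : PlaneL2}
    (hf : MemMultiplierDomain symDxHalf f) (hfm : MemMultiplierDomain m f) {t : ℝ} (ht : 0 ≤ t) :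
    ∫⁻ ζ, ENNReal.ofReal (anisoWeight r t ζ) * ‖(𝓕 f : PlaneL2) ζ‖ₑ ^ 2 ≤
      ENNReal.ofReal (‖multiplierOp symDxHalf f‖ ^ 2 + t * ‖multiplierOp m f‖ ^ 2) := by
  have hpt : ∀ ζ : Plane, ENNReal.ofReal (anisoWeight r t ζ) ≤
      ‖symDxHalf ζ‖ₑ ^ 2 + ENNReal.ofReal t * ‖m ζ‖ₑ ^ 2 := by
    intro ζ
    rw [← ofReal_norm, ← ofReal_norm, ← ENNReal.ofReal_pow (norm_nonneg _),
      ← ENNReal.ofReal_pow (norm_nonneg _), ← ENNReal.ofReal_mul ht,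
      ← ENNReal.ofReal_add (by positivity) (by positivity)]
    exact ENNReal.ofReal_le_ofReal (add_le_add (abs_le_norm_symDxHalf_sq ζ)
      (mul_le_mul_of_nonneg_left (hm ζ) ht))
  have hmeas : AEMeasurable (fun ζ => ‖symDxHalf ζ‖ₑ ^ 2 * ‖(𝓕 f : PlaneL2) ζ‖ₑ ^ 2) volume := by
    simp_rw [← mul_pow, ← enorm_mul]
    exact hf.1.enorm.pow_const 2
  calc _ ≤ ∫⁻ ζ, (‖symDxHalf ζ‖ₑ ^ 2 * ‖(𝓕 f : PlaneL2) ζ‖ₑ ^ 2 +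
          ENNReal.ofReal t * (‖m ζ‖ₑ ^ 2 * ‖(𝓕 f : PlaneL2) ζ‖ₑ ^ 2)) := by
        refine lintegral_mono fun ζ => ?_
        rw [← mul_assoc, ← add_mul]
        gcongr
        exact hpt ζ
    _ = _ := by
        rw [lintegral_add_left' hmeas, lintegral_const_mul' _ _ ENNReal.ofReal_ne_top,
          lintegral_enorm_symbol_eq hf, lintegral_enorm_symbol_eq hfm, ← ENNReal.ofReal_mul ht,
          ← ENNReal.ofReal_add (by positivity) (by positivity)]

/-! ### Endpoint inequality and interpolation. -/

/-- The endpoint anisotropic Sobolev inequality in multiplicative form. -/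
theorem exists_lintegral_enorm_rpow_le {r : ℝ} (hr : 0 < r) {m : Plane → ℂ}
    (hm : ∀ ζ : Plane, ζ 1 ^ 2 * |ζ 0| ^ (-(2 * r)) ≤ ‖m ζ‖ ^ 2) :
    ∃ C : ℝ, 0 < C ∧ ∀ f : PlaneL2, MemMultiplierDomain symDxHalf f → MemMultiplierDomain m f →
      ∫⁻ x, ‖f x‖ₑ ^ (2 + 2 / (r + 1 / 2)) ≤
        ENNReal.ofReal (C * ((‖multiplierOp m f‖ * ‖multiplierOp symDxHalf f‖) ^
          (1 / (r + 1 / 2)) * ‖multiplierOp symDxHalf f‖ ^ 2)) := by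
  set a : ℝ := r + 1 / 2 with ha
  have ha0 : 0 < a := by positivity
  refine ⟨(2 + 2 / a) * 4 / (2 / a) * (32 / r) ^ (1 / a) * 2, by positivity, ?_⟩
  intro f hf hfm
  set A₀ := ‖multiplierOp m f‖ with hA₀
  set B₀ := ‖multiplierOp symDxHalf f‖ with hB₀
  have hA₀' : 0 ≤ A₀ := norm_nonneg _
  have hB₀' : 0 ≤ B₀ := norm_nonneg _
  -- The balancing value t = B²/A² needs nonzero norms, so the bound is proved for positive
  -- majorants `A`, `B` of the two norms. It gives N = 2B² and 4KN = (32/r)AB.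
  have key : ∀ A B : ℝ, 0 < A → 0 < B → A₀ ≤ A → B₀ ≤ B → ∫⁻ x, ‖f x‖ₑ ^ (2 + 2 / a) ≤
      ENNReal.ofReal ((2 + 2 / a) * 4 / (2 / a) * (32 / r) ^ (1 / a) * 2 *
        ((A * B) ^ (1 / a) * B ^ 2)) := by
    intro A B hA hB hAA hBB
    have ht : 0 < B ^ 2 / A ^ 2 := by positivity
    have hN : ∫⁻ ζ, ENNReal.ofReal (anisoWeight r (B ^ 2 / A ^ 2) ζ) *
        ‖(𝓕 f : PlaneL2) ζ‖ₑ ^ 2 ≤ ENNReal.ofReal (2 * B ^ 2) := by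
      refine (lintegral_anisoWeight_le hm hf hfm ht.le).trans (ENNReal.ofReal_le_ofReal ?_)
      calc _ ≤ B ^ 2 + B ^ 2 / A ^ 2 * A ^ 2 := by gcongr
        _ = _ := by field_simp; ring
    refine (lintegral_enorm_rpow_le_of_weight (measurable_anisoWeight r (B ^ 2 / A ^ 2))
      (anisoWeight_nonneg r ht.le) (anisoWeight_pos r ht.le)
      (K := 4 / r * (B ^ 2 / A ^ 2) ^ (-(1 / 2) : ℝ)) (by positivity) ha0
      (fun M hM => setLIntegral_inv_anisoWeight_le hr ht hM) f (by positivity) hN).trans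
      (le_of_eq ?_)
    have hK : 4 * (4 / r * (B ^ 2 / A ^ 2) ^ (-(1 / 2) : ℝ)) * (2 * B ^ 2) = 32 / r * (A * B) := by
      rw [Real.rpow_neg ht.le, ← Real.sqrt_eq_rpow, ← div_pow, Real.sqrt_sq (by positivity)]
      field_simp
      ring
    rw [hK, Real.mul_rpow (by positivity) (by positivity)]
    congr 1
    ring
  -- Taking majorants `A₀ + ε`, `B₀ + ε` and letting ε ↓ 0 covers vanishing norms too.
  have hcont : Continuous fun ε : ℝ => ENNReal.ofReal ((2 + 2 / a) * 4 / (2 / a) *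
      (32 / r) ^ (1 / a) * 2 * (((A₀ + ε) * (B₀ + ε)) ^ (1 / a) * (B₀ + ε) ^ 2)) := by
    refine ENNReal.continuous_ofReal.comp (continuous_const.mul (Continuous.mul ?_ (by fun_prop)))
    exact Continuous.rpow_const (by fun_prop) fun _ => Or.inr (by positivity)
  have hlim := (hcont.tendsto 0).mono_left (nhdsWithin_le_nhds (s := Set.Ioi 0))
  simp only [add_zero] at hlim
  refine ge_of_tendsto hlim ?_
  filter_upwards [self_mem_nhdsWithin] with ε hε
  have hε : 0 < ε := hε
  exact key _ _ (by positivity) (by positivity) (by linarith) (by linarith)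

/-- Hölder for the product (|f|²)^{1-θ} (|f|^{2+b})^θ. -/
theorem lintegral_enorm_rpow_interpolate {α F : Type*} [MeasurableSpace α] [NormedAddCommGroup F]
    {μ : Measure α} (f : Lp F 2 μ) {b θ : ℝ} (hb : 0 ≤ b) (h0 : 0 ≤ θ) (h1 : θ ≤ 1) :
    ∫⁻ x, ‖f x‖ₑ ^ (2 + θ * b) ∂μ ≤
      ENNReal.ofReal (‖f‖ ^ 2) ^ (1 - θ) * (∫⁻ x, ‖f x‖ₑ ^ (2 + b) ∂μ) ^ θ := by
  rw [← lintegral_enorm_sq_eq]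
  have hm := (Lp.aestronglyMeasurable f).enorm
  calc _ = ∫⁻ x, (‖f x‖ₑ ^ 2) ^ (1 - θ) * (‖f x‖ₑ ^ (2 + b)) ^ θ ∂μ := by
        refine lintegral_congr fun x => ?_
        rw [← ENNReal.rpow_natCast, ← ENNReal.rpow_mul, ← ENNReal.rpow_mul,
          ← ENNReal.rpow_add_of_nonneg _ _ (mul_nonneg (by positivity) (by linarith))
            (by positivity)]
        congr 1
        push_cast
        ring
    _ ≤ _ := ENNReal.lintegral_mul_norm_pow_le (hm.pow_const 2) (hm.pow_const _)
        (by linarith) h0 (by ring)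

theorem memLq_and_lqNorm_rpow_le {q D : ℝ} (hq : 0 < q) (hD : 0 ≤ D) {f : PlaneL2}
    (h : ∫⁻ x, ‖f x‖ₑ ^ q ≤ ENNReal.ofReal D) : MemLq q f ∧ lqNorm q f ^ q ≤ D := by
  have hq0 : ENNReal.ofReal q ≠ 0 := by simpa using hq
  have heq := eLpNorm_eq_lintegral_rpow_enorm_toReal (f := f) (μ := volume) hq0
    ENNReal.ofReal_ne_top
  rw [ENNReal.toReal_ofReal hq.le] at heq
  constructor
  · refine ⟨Lp.aestronglyMeasurable f, ?_⟩
    rw [heq]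
    exact ENNReal.rpow_lt_top_of_nonneg (by positivity) (ne_top_of_le_ne_top ENNReal.ofReal_ne_top h)
  · rw [lqNorm, ENNReal.toReal_rpow, heq, ← ENNReal.rpow_mul, one_div_mul_cancel hq.ne',
      ENNReal.rpow_one]
    exact ENNReal.toReal_le_of_le_ofReal hD h

/-- The anisotropic Gagliardo–Nirenberg inequality. -/
theorem exists_lqNorm_rpow_le {r : ℝ} (hr : 0 < r) {m : Plane → ℂ}
    (hm : ∀ ζ : Plane, ζ 1 ^ 2 * |ζ 0| ^ (-(2 * r)) ≤ ‖m ζ‖ ^ 2) {p : ℝ} (hp : 0 ≤ p)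
    (hpr : p * (r + 1 / 2) ≤ 2) :
    ∃ C : ℝ, 0 < C ∧ ∀ f : PlaneL2, MemMultiplierDomain symDxHalf f → MemMultiplierDomain m f →
      MemLq (p + 2) f ∧ lqNorm (p + 2) f ^ (p + 2) ≤
        C * ‖f‖ ^ (2 - p * (r + 1 / 2)) * ‖multiplierOp m f‖ ^ (p / 2) *
          ‖multiplierOp symDxHalf f‖ ^ (p / 2 + p * (r + 1 / 2)) := by
  obtain ⟨C, hC, H⟩ := exists_lintegral_enorm_rpow_le hr hm
  set a : ℝ := r + 1 / 2 with ha
  have ha0 : 0 < a := by positivity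
  -- Forced by 2 + θ(2/a) = p + 2; the condition θ ≤ 1 is exactly `hpr`.
  set θ : ℝ := p * a / 2 with hθ
  have hθ0 : 0 ≤ θ := by positivity
  have hθ1 : θ ≤ 1 := by rw [hθ]; linarith
  refine ⟨C ^ θ, by positivity, fun f hf hfm => ?_⟩
  set A := ‖multiplierOp m f‖ with hA
  set B := ‖multiplierOp symDxHalf f‖ with hB
  have hA0 : 0 ≤ A := norm_nonneg _
  have hB0 : 0 ≤ B := norm_nonneg _
  refine memLq_and_lqNorm_rpow_le (by positivity) (by positivity) ?_
  have h := lintegral_enorm_rpow_interpolate f (b := 2 / a) (by positivity) hθ0 hθ1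
  have he : 2 + θ * (2 / a) = p + 2 := by rw [hθ]; field_simp; ring
  rw [he] at h
  calc _ ≤ _ := h
    _ ≤ ENNReal.ofReal (‖f‖ ^ 2) ^ (1 - θ) *
        ENNReal.ofReal (C * ((A * B) ^ (1 / a) * B ^ 2)) ^ θ := by
      gcongr
      exact H f hf hfm
    _ = _ := by
      rw [ENNReal.ofReal_rpow_of_nonneg (by positivity) (by linarith),
        ENNReal.ofReal_rpow_of_nonneg (by positivity) hθ0, ← ENNReal.ofReal_mul (by positivity)]
      congr 1
      rw [Real.mul_rpow hC.le (by positivity), Real.mul_rpow (by positivity) (by positivity),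
        ← Real.rpow_mul (by positivity), Real.mul_rpow hA0 hB0,
        Real.rpow_add_of_nonneg hB0 (by positivity) (by positivity),
        ← Real.rpow_natCast, ← Real.rpow_natCast, ← Real.rpow_mul (norm_nonneg _),
        ← Real.rpow_mul hB0,
        show ((2 : ℕ) : ℝ) * (1 - θ) = 2 - p * a by rw [hθ]; push_cast; ring,
        show ((2 : ℕ) : ℝ) * θ = p * a by rw [hθ]; push_cast; ring,
        show 1 / a * θ = p / 2 by rw [hθ]; field_simp]
      ring

/-! ### From the multiplicative inequalities to the embedding. -/

/-- The right side is homogeneous of total degree q, so bounding each factor by a multiple of `N`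
gives `N ^ q`, and a q-th root finishes. -/
theorem le_const_mul_of_rpow_le {L q C k x y z N α β γ : ℝ} (hL : 0 ≤ L) (hq : 0 < q) (hC : 0 < C)
    (hk : 0 < k) (hx : 0 ≤ x) (hy : 0 ≤ y) (hz : 0 ≤ z) (hxN : x ≤ N) (hyN : y ≤ k * N)
    (hzN : z ≤ N) (hα : 0 ≤ α) (hβ : 0 ≤ β) (hγ : 0 ≤ γ) (hsum : α + β + γ = q)
    (h : L ^ q ≤ C * x ^ α * y ^ β * z ^ γ) : L ≤ (C * k ^ β) ^ q⁻¹ * N := by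
  have hN : 0 ≤ N := hx.trans hxN
  have h1 : L ^ q ≤ C * k ^ β * N ^ q := by
    calc _ ≤ _ := h
      _ ≤ C * N ^ α * (k * N) ^ β * N ^ γ := by gcongr
      _ = _ := by
        rw [Real.mul_rpow hk.le hN, ← hsum, Real.rpow_add_of_nonneg hN (by positivity) hγ,
          Real.rpow_add_of_nonneg hN hα hβ]
        ring
  have h2 := (Real.le_rpow_inv_iff_of_pos hL (by positivity) hq).2 h1
  rwa [Real.mul_rpow (by positivity) (by positivity), Real.rpow_rpow_inv hN hq.ne'] at h2

theorem norm_le_XHalfNorm {lam mu : ℝ} (hlam : 0 ≤ lam) (hmu : 0 ≤ mu) (f : PlaneL2) :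
    ‖f‖ ≤ XHalfNorm lam mu f := by
  refine Real.le_sqrt_of_sq_le ?_
  have h1 := mul_nonneg hlam (sq_nonneg ‖multiplierOp symDxNegHalfPartialY f‖)
  have h2 := mul_nonneg hmu (sq_nonneg ‖multiplierOp symInvPartialXPartialY f‖)
  have h3 := sq_nonneg ‖multiplierOp symDxHalf f‖
  linarith

theorem norm_multiplierOp_symDxHalf_le {lam mu : ℝ} (hlam : 0 ≤ lam) (hmu : 0 ≤ mu)
    (f : PlaneL2) : ‖multiplierOp symDxHalf f‖ ≤ XHalfNorm lam mu f := by
  refine Real.le_sqrt_of_sq_le ?_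
  have h1 := mul_nonneg hlam (sq_nonneg ‖multiplierOp symDxNegHalfPartialY f‖)
  have h2 := mul_nonneg hmu (sq_nonneg ‖multiplierOp symInvPartialXPartialY f‖)
  have h3 := sq_nonneg ‖f‖
  linarith

theorem norm_multiplierOp_symDxNegHalfPartialY_le {lam mu : ℝ} (hlam : 0 < lam) (hmu : 0 ≤ mu)
    (f : PlaneL2) :
    ‖multiplierOp symDxNegHalfPartialY f‖ ≤ (Real.sqrt lam)⁻¹ * XHalfNorm lam mu f := by
  rw [← div_eq_inv_mul, le_div_iff₀ (Real.sqrt_pos.2 hlam)]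
  refine Real.le_sqrt_of_sq_le ?_
  rw [mul_pow, Real.sq_sqrt hlam.le]
  have h2 := mul_nonneg hmu (sq_nonneg ‖multiplierOp symInvPartialXPartialY f‖)
  have h3 := sq_nonneg ‖f‖
  have h4 := sq_nonneg ‖multiplierOp symDxHalf f‖
  linarith

theorem norm_multiplierOp_symInvPartialXPartialY_le {lam mu : ℝ} (hlam : 0 ≤ lam) (hmu : 0 < mu)
    (f : PlaneL2) :
    ‖multiplierOp symInvPartialXPartialY f‖ ≤ (Real.sqrt mu)⁻¹ * XHalfNorm lam mu f := by
  rw [← div_eq_inv_mul, le_div_iff₀ (Real.sqrt_pos.2 hmu)]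
  refine Real.le_sqrt_of_sq_le ?_
  rw [mul_pow, Real.sq_sqrt hmu.le]
  have h1 := mul_nonneg hlam (sq_nonneg ‖multiplierOp symDxNegHalfPartialY f‖)
  have h3 := sq_nonneg ‖f‖
  have h4 := sq_nonneg ‖multiplierOp symDxHalf f‖
  linarith

theorem mainTheorem6 (lam mu : ℝ) (hlam : 0 ≤ lam) (hmu : 0 ≤ mu) (p : ℝ) (hp : 0 ≤ p) :
    (0 < lam → p ≤ 2 →
      ∃ C : ℝ, 0 < C ∧ ∀ f ∈ XHalf lam mu, MemLq (p + 2) f ∧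
        lqNorm (p + 2) f ^ (p + 2) ≤
          C * ‖f‖ ^ (2 - p) * ‖multiplierOp symDxNegHalfPartialY f‖ ^ (p / 2) *
            ‖multiplierOp symDxHalf f‖ ^ (3 * p / 2)) ∧
    (lam = 0 → 0 < mu → p ≤ 4 / 3 →
      ∃ C : ℝ, 0 < C ∧ ∀ f ∈ XHalf lam mu, MemLq (p + 2) f ∧
        lqNorm (p + 2) f ^ (p + 2) ≤
          C * ‖f‖ ^ ((4 - 3 * p) / 2) * ‖multiplierOp symDxHalf f‖ ^ (2 * p) *
            ‖multiplierOp symInvPartialXPartialY f‖ ^ (p / 2)) ∧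
    ((0 < lam ∧ p ≤ 2) ∨ (lam = 0 ∧ 0 < mu ∧ p ≤ 4 / 3) →
      ∃ C : ℝ, 0 < C ∧ ∀ f ∈ XHalf lam mu, MemLq (p + 2) f ∧
        lqNorm (p + 2) f ≤ C * XHalfNorm lam mu f) := by
  have ha : 0 < lam → p ≤ 2 →
      ∃ C : ℝ, 0 < C ∧ ∀ f ∈ XHalf lam mu, MemLq (p + 2) f ∧
        lqNorm (p + 2) f ^ (p + 2) ≤
          C * ‖f‖ ^ (2 - p) * ‖multiplierOp symDxNegHalfPartialY f‖ ^ (p / 2) *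
            ‖multiplierOp symDxHalf f‖ ^ (3 * p / 2) := by
    intro hl hp2
    obtain ⟨C, hC, H⟩ := exists_lqNorm_rpow_le one_half_pos le_norm_symDxNegHalfPartialY_sq hp
      (by linarith)
    refine ⟨C, hC, fun f hf => ?_⟩
    have h := H f hf.1 (hf.2.1 hl.ne')
    rwa [show 2 - p * (1 / 2 + 1 / 2) = 2 - p by ring,
      show p / 2 + p * (1 / 2 + 1 / 2) = 3 * p / 2 by ring] at h
  have hb : lam = 0 → 0 < mu → p ≤ 4 / 3 →
      ∃ C : ℝ, 0 < C ∧ ∀ f ∈ XHalf lam mu, MemLq (p + 2) f ∧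
        lqNorm (p + 2) f ^ (p + 2) ≤
          C * ‖f‖ ^ ((4 - 3 * p) / 2) * ‖multiplierOp symDxHalf f‖ ^ (2 * p) *
            ‖multiplierOp symInvPartialXPartialY f‖ ^ (p / 2) := by
    intro _ hm hp2
    obtain ⟨C, hC, H⟩ := exists_lqNorm_rpow_le one_pos le_norm_symInvPartialXPartialY_sq hp
      (by linarith)
    refine ⟨C, hC, fun f hf => ?_⟩
    have h := H f hf.1 (hf.2.2 hm.ne')
    rwa [show 2 - p * (1 + 1 / 2) = (4 - 3 * p) / 2 by ring,
      show p / 2 + p * (1 + 1 / 2) = 2 * p by ring, mul_right_comm] at h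
  refine ⟨ha, hb, ?_⟩
  rintro (⟨hl, hp2⟩ | ⟨hl, hm, hp2⟩)
  · obtain ⟨C, hC, H⟩ := ha hl hp2
    have hk : 0 < (Real.sqrt lam)⁻¹ := inv_pos.2 (Real.sqrt_pos.2 hl)
    refine ⟨(C * (Real.sqrt lam)⁻¹ ^ (p / 2)) ^ (p + 2)⁻¹, by positivity, fun f hf =>
      ⟨(H f hf).1, ?_⟩⟩
    exact le_const_mul_of_rpow_le ENNReal.toReal_nonneg (by positivity) hC hk (norm_nonneg _)
      (norm_nonneg _) (norm_nonneg _) (norm_le_XHalfNorm hlam hmu f)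
      (norm_multiplierOp_symDxNegHalfPartialY_le hl hmu f)
      (norm_multiplierOp_symDxHalf_le hlam hmu f) (by linarith) (by positivity) (by positivity)
      (by ring) (H f hf).2
  · obtain ⟨C, hC, H⟩ := hb hl hm hp2
    have hk : 0 < (Real.sqrt mu)⁻¹ := inv_pos.2 (Real.sqrt_pos.2 hm)
    refine ⟨(C * (Real.sqrt mu)⁻¹ ^ (p / 2)) ^ (p + 2)⁻¹, by positivity, fun f hf =>
      ⟨(H f hf).1, ?_⟩⟩
    refine le_const_mul_of_rpow_le ENNReal.toReal_nonneg (by positivity) hC hk (norm_nonneg _)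
      (norm_nonneg _) (norm_nonneg _) (norm_le_XHalfNorm hlam hmu f)
      (norm_multiplierOp_symInvPartialXPartialY_le hlam hm f)
      (norm_multiplierOp_symDxHalf_le hlam hmu f) (by linarith) (by positivity) (by positivity)
      (by ring) ((H f hf).2.trans (le_of_eq (mul_right_comm _ _ _)))
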